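/- Let $M\ge 1$, let $d_1,\dots,d_M\ge 1$ be integers, $d=d_1+\dots+d_M$, and write $\mathbb{R}^d=\mathbb{R}^{d_1}\times\dots\times\mathbb{R}^{d_M}$. For $S\subseteq\{1,\dots,M\}$ and $x=(x_1,\dots,x_M)$ put $x_S=(x_m)_{m\in S}$ and $x_{-S}=(x_m)_{m\notin S}$, and let $\mu_{-S}$ be the law of $X_{-S}$ when $X\sim\mu$. Let $\pi(\mathrm{d}x)=e^{-U(x)}\,\mathrm{d}x$ be a probability measure on $\mathbb{R}^d$, where $U:\mathbb{R}^d\to\mathbb{R}$ is convex and differentiable, $\nabla U$ is $L$-Lipschitz for the Euclidean norm, and $x\mapsto U(x)-\frac{\lambda}{2}\|x\|^2$ is convex, with $\lambda>0$. Put $\kappa=L/\lambda$ and let $\ell\in\{1,\dots,M\}$. For $S\subseteq\{1,\dots,M\}$ let $P_S(x,\cdot)$ be the law of the point $y$ with $y_{-S}=x_{-S}$ and $y_S\sim\pi(\cdot\mid x_{-S})$, the conditional distribution of $X_S$ given $X_{-S}=x_{-S}$ under $X\sim\pi$. Let $$P^{\mathrm{GS},\ell}=\binom{M}{\ell}^{-1}\sum_{|S|=\ell}P_S$$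 be the Gibbs sampler that at each step resamples $\ell$ uniformly chosen blocks out of $M$ from their joint conditional distribution, and write $\mu P(A)=\int P(x,A)\,\mu(\mathrm{d}x)$. Let $\mathrm{KL}(\mu|\nu)=\int\log\frac{\mathrm{d}\mu}{\mathrm{d}\nu}\,\mathrm{d}\mu$ if $\mu\ll\nu$, and $+\infty$ otherwise. Then, for every probability measure $\mu$ on $\mathbb{R}^d$ (with the convention $0\cdot\infty=0$), $$\mathrm{KL}(\mu P^{\mathrm{GS},\ell}\,|\,\pi)\le\Bigl(1-\frac{\ell}{\kappa M}\Bigr)\mathrm{KL}(\mu|\pi),$$ and moreover the averaged marginal entropies satisfy $$\binom{M}{\ell}^{-1}\sum_{|S|=\ell}\mathrm{KL}(\mu_{-S}|\pi_{-S})\le\Bigl(1-\frac{\ell}{\kappa M}\Bigr)\mathrm{KL}(\mu|\pi),$$ the sums running over all subsets $S$ of $\{1,\dots,M\}$ with $\ell$ elements. -/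

import Mathlib

open MeasureTheory ProbabilityTheory InformationTheory
open scoped NNReal ENNReal

namespace BlockGibbs

/-- `ℝ^d = ℝ^{d_1} × ⋯ × ℝ^{d_M}` with its Euclidean structure and Lebesgue measure; the coordinate
`⟨m, i⟩` is the `i`-th coordinate of the `m`-th block. -/
abbrev Space {M : ℕ} (d : Fin M → ℕ) : Type :=
  EuclideanSpace ℝ ((m : Fin M) × Fin (d m))

/-- `𝒳_S = ∏_{m ∈ S} ℝ^{d_m}`: the coordinates of the blocks in `S`. -/
abbrev Blocks {M : ℕ} (d : Fin M → ℕ) (S : Finset (Fin M)) : Type :=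
  {j : (m : Fin M) × Fin (d m) // j.1 ∈ S} → ℝ

/-- The projection `x ↦ x_S`. The projection `x ↦ x_{-S}` is `proj Sᶜ`. -/
def proj {M : ℕ} {d : Fin M → ℕ} (S : Finset (Fin M)) (x : Space d) : Blocks d S :=
  fun j => x j.1

/-- The point `(y_S, x_{-S})`: `x` with its blocks in `S` replaced by those of `y`. -/
def replace {M : ℕ} {d : Fin M → ℕ} (S : Finset (Fin M)) (x : Space d) (y : Blocks d S) : Space d :=
  WithLp.toLp 2 fun j => if h : j.1 ∈ S then y ⟨j, h⟩ else x j

theorem measurable_proj {M : ℕ} {d : Fin M → ℕ} (S : Finset (Fin M)) :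
    Measurable (proj S : Space d → Blocks d S) := by
  unfold proj
  fun_prop

theorem measurable_replace {M : ℕ} {d : Fin M → ℕ} (S : Finset (Fin M)) :
    Measurable fun p : Space d × Blocks d S => replace S p.1 p.2 := by
  unfold replace
  refine (WithLp.measurable_toLp 2 _).comp (measurable_pi_lambda _ fun j => ?_)
  by_cases h : j.1 ∈ S
  · simp only [h, dite_true]
    fun_prop
  · simp only [h, dite_false]
    fun_prop

/-- The conditional distribution `π(· | x_{-S})` of `x_S` given `x_{-S}` under `x ∼ π`. -/
noncomputable def condBlocks {M : ℕ} {d : Fin M → ℕ} (π : Measure (Space d)) [IsProbabilityMeasure π]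
    (S : Finset (Fin M)) : Kernel (Blocks d Sᶜ) (Blocks d S) :=
  condDistrib (proj S) (proj Sᶜ) π

/-- The kernel `P_S`: `P_S(x, ·)` is the law of `(y_S, x_{-S})` with `y_S ∼ π(· | x_{-S})`
(see `blockUpdate_apply`). -/
noncomputable def blockUpdate {M : ℕ} {d : Fin M → ℕ} (π : Measure (Space d))
    [IsProbabilityMeasure π] (S : Finset (Fin M)) : Kernel (Space d) (Space d) :=
  (Kernel.id ×ₖ (condBlocks π S).comap (proj Sᶜ) (measurable_proj Sᶜ)).map
    fun p => replace S p.1 p.2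

theorem blockUpdate_apply {M : ℕ} {d : Fin M → ℕ} (π : Measure (Space d))
    [IsProbabilityMeasure π] (S : Finset (Fin M)) (x : Space d) :
    blockUpdate π S x = (condBlocks π S (proj Sᶜ x)).map (replace S x) := by
  unfold blockUpdate condBlocks
  rw [Kernel.map_apply _ (measurable_replace S), Kernel.prod_apply, Kernel.id_apply,
    Kernel.comap_apply, Measure.dirac_prod,
    Measure.map_map (measurable_replace S) (by fun_prop)]
  rfl

/-- The kernel `P^{GS,ℓ}`: the average of `P_S` over the `ℓ`-element sets `S` of blocks, i.e.
`S` is drawn uniformly among them and then the blocks in `S` are resampled jointly. -/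
noncomputable def gibbs {M : ℕ} {d : Fin M → ℕ} (π : Measure (Space d)) [IsProbabilityMeasure π]
    (ℓ : ℕ) : Kernel (Space d) (Space d) where
  toFun x := ((M.choose ℓ : ℝ≥0∞))⁻¹ •
    ∑ S ∈ (Finset.univ : Finset (Fin M)).powersetCard ℓ, blockUpdate π S x
  measurable' := by
    refine Measure.measurable_of_measurable_coe _ fun A hA => ?_
    simp only [Measure.smul_apply, Measure.finsetSum_apply, smul_eq_mul]
    exact (Finset.measurable_sum _ fun S _ =>
      Kernel.measurable_coe (blockUpdate π S) hA).const_mul _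

/-- `U` is convex, `L`-smooth and `lam`-convex with `lam > 0`. -/
structure IsConvexSmooth {M : ℕ} {d : Fin M → ℕ} (U : Space d → ℝ) (lam : ℝ) (L : ℝ≥0) :
    Prop where
  convex : ConvexOn ℝ Set.univ U
  differentiable : Differentiable ℝ U
  smooth : LipschitzWith L (gradient U)
  lam_pos : 0 < lam
  strongly_convex : ConvexOn ℝ Set.univ fun x => U x - lam / 2 * ‖x‖ ^ 2

end BlockGibbs

namespace BlockGibbs
open Set Pointwise Filter Topology

/-! The Gibbs bound follows from the marginal bound: `P_S` ignores `x_S` and preserves `π`, so data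
processing gives KL(μP_S|π) ≤ KL(μ_{-S}|π_{-S}), and KL is convex in its first argument
(`klDiv_gibbs_comp_le`).

For the marginal bound, let N = binom(M,ℓ), let C = binom(M-1,ℓ-1) be the number of ℓ-sets S
containing a given block, and put c = N - tC with t ≤ λ/L. Move x a fraction t towards y, but only
in the blocks of S, and sum over S. The descent lemma at x and strong convexity between x and y give
Σ_S U(x + t(y-x)_S) ≤ c U(x) + tC U(y) (`sum_interp_le`).

This feeds a Prékopa–Leindler inequality for N functions at partially interpolated points
(`lintegral_pi_rpow_mul_le_prod_lintegral`). A factor φ_S depending only on x_{-S} does not see the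
move, so ∫ φ_S dπ ≤ 1 for all S implies ∫ (∏ φ_S)^{1/c} dπ ≤ 1 (`lintegral_prod_rpow_le_one`).
Testing the Gibbs variational inequality with φ_S = dμ_{-S}/dπ_{-S} yields Σ_S KL(μ_{-S}|π_{-S}) ≤ c
KL(μ|π) (`sum_klDiv_map_le`). Since C/N = ℓ/M, letting t increase to λ/L finishes the proof. -/

/-! ### Brunn–Minkowski and Prékopa–Leindler on the line -/

/-- The translates K + min L and max K + L both lie in K + L and meet in at most one point. -/
theorem volume_add_le_of_isCompact {K L : Set ℝ} (hK : IsCompact K) (hL : IsCompact L)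
    (hK0 : K.Nonempty) (hL0 : L.Nonempty) : volume K + volume L ≤ volume (K + L) := by
  obtain ⟨a, haK, ha⟩ := hK.exists_isGreatest hK0
  obtain ⟨b, hbL, hb⟩ := hL.exists_isLeast hL0
  have h1 : volume ((· + b) '' K) = volume K := by
    rw [Set.image_add_right, measure_preimage_add_right]
  have h2 : volume ((a + ·) '' L) = volume L := by
    rw [Set.image_add_left, measure_preimage_add]
  have hd : AEDisjoint volume ((· + b) '' K) ((a + ·) '' L) := by
    refine measure_mono_null (t := {a + b}) ?_ (by simp)
    rintro _ ⟨⟨x, hx, rfl⟩, ⟨y, hy, hxy⟩⟩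
    have := ha hx
    have := hb hy
    simp only [mem_singleton_iff] at *
    linarith
  have hm : MeasurableSet ((a + ·) '' L) := (hL.image (by fun_prop)).measurableSet
  rw [← h1, ← h2, ← measure_union₀ hm.nullMeasurableSet hd]
  refine measure_mono (union_subset ?_ ?_)
  · rintro _ ⟨x, hx, rfl⟩
    exact add_mem_add hx hbL
  · rintro _ ⟨y, hy, rfl⟩
    exact add_mem_add haK hy

theorem exists_nonempty_isCompact_lt {A : Set ℝ} (hA : MeasurableSet A) (hA0 : A.Nonempty)
    {r : ℝ≥0∞} (hr : r < volume A) : ∃ K ⊆ A, IsCompact K ∧ K.Nonempty ∧ r < volume K := by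
  obtain ⟨K, hKA, hK, hrK⟩ := hA.exists_lt_isCompact hr
  obtain ⟨a, ha⟩ := hA0
  exact ⟨insert a K, insert_subset ha hKA, hK.insert a, insert_nonempty _ _,
    hrK.trans_le (measure_mono (subset_insert _ _))⟩

/-- One-dimensional Brunn–Minkowski inequality. -/
theorem volume_add_le {A B W : Set ℝ} (hA : MeasurableSet A) (hB : MeasurableSet B)
    (hA0 : A.Nonempty) (hB0 : B.Nonempty) {t : ℝ} (ht0 : 0 < t) (ht1 : t < 1)
    (hW : ∀ a ∈ A, ∀ b ∈ B, (1 - t) * a + t * b ∈ W) :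
    ENNReal.ofReal (1 - t) * volume A + ENNReal.ofReal t * volume B ≤ volume W := by
  have hsm : ∀ (r : ℝ) (S : Set ℝ), 0 < r → volume (r • S) = ENNReal.ofReal r * volume S := by
    intro r S hr
    rw [Measure.addHaar_smul]
    simp [abs_of_pos hr]
  have hms : ∀ (r : ℝ) (S : Set ℝ), 0 < r → MeasurableSet S → MeasurableSet (r • S) :=
    fun r S hr hS => hS.const_smul₀ r
  rw [← hsm _ _ ht0, ← hsm _ _ (sub_pos.2 ht1)]
  -- Null sets are treated apart, since splitting r below needs both volumes nonzero; here W
  -- contains a translate of the other scaled set.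
  by_cases hA' : volume ((1 - t) • A) = 0
  · rw [hA', zero_add]
    obtain ⟨a, ha⟩ := hA0
    have : volume (((1 - t) * a + ·) '' (t • B)) = volume (t • B) := by
      rw [Set.image_add_left, measure_preimage_add]
    rw [← this]
    refine measure_mono ?_
    rintro _ ⟨_, ⟨b, hb, rfl⟩, rfl⟩
    exact hW a ha b hb
  by_cases hB' : volume (t • B) = 0
  · rw [hB', add_zero]
    obtain ⟨b, hb⟩ := hB0
    have : volume ((· + t * b) '' ((1 - t) • A)) = volume ((1 - t) • A) := by
      rw [Set.image_add_right, measure_preimage_add_right]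
    rw [← this]
    refine measure_mono ?_
    rintro _ ⟨_, ⟨a, ha, rfl⟩, rfl⟩
    exact hW a ha b hb
  refine le_of_forall_lt fun r hr => ?_
  obtain ⟨r₁, h1, r₂, h2, hr'⟩ := ENNReal.exists_lt_add_of_lt_add hr hA' hB'
  obtain ⟨K, hKA, hK, hK0, hrK⟩ := exists_nonempty_isCompact_lt
    (hms _ A (sub_pos.2 ht1) hA) hA0.smul_set h1
  obtain ⟨L, hLB, hL, hL0, hrL⟩ := exists_nonempty_isCompact_lt
    (hms _ B ht0 hB) hB0.smul_set h2
  calc r < r₁ + r₂ := hr'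
    _ ≤ volume K + volume L := add_le_add hrK.le hrL.le
    _ ≤ volume (K + L) := volume_add_le_of_isCompact hK hL hK0 hL0
    _ ≤ volume W := by
      refine measure_mono ?_
      rintro _ ⟨x, hx, y, hy, rfl⟩
      obtain ⟨a, ha, rfl⟩ := hKA hx
      obtain ⟨b, hb, rfl⟩ := hLB hy
      exact hW a ha b hb

theorem lintegral_eq_lintegral_Ioo_meas_lt {f : ℝ → ℝ≥0∞} (hf : Measurable f)
    (hf1 : ∀ x, f x ≤ 1) :
    ∫⁻ x, f x = ∫⁻ s in Ioo (0 : ℝ) 1, volume {x | ENNReal.ofReal s < f x} := by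
  have hfin : ∀ x, f x ≠ ∞ := fun x => ((hf1 x).trans_lt ENNReal.one_lt_top).ne
  have h := lintegral_eq_lintegral_meas_lt volume (f := fun x => (f x).toReal)
    (ae_of_all _ fun x => ENNReal.toReal_nonneg) hf.ennreal_toReal.aemeasurable
  simp only [ENNReal.ofReal_toReal (hfin _)] at h
  rw [h, ← Set.Ioo_union_Ici_eq_Ioi (zero_lt_one' ℝ), lintegral_union measurableSet_Ici
    (by
      rw [Set.disjoint_left]
      intro x hx hx'
      exact absurd hx.2 (not_lt.2 hx'))]
  have h0 : ∫⁻ s in Ici (1 : ℝ), volume {x | s < (f x).toReal} = 0 := by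
    rw [setLIntegral_congr_fun measurableSet_Ici (g := fun _ => 0)]
    · simp
    · intro s hs
      have : {x | s < (f x).toReal} = ∅ := by
        ext x
        simp only [mem_ofPred_eq, mem_empty_iff_false, iff_false, not_lt]
        exact (ENNReal.toReal_mono ENNReal.one_ne_top (hf1 x)).trans (by simpa using hs)
      simp [this]
  rw [h0, add_zero]
  refine setLIntegral_congr_fun measurableSet_Ioo fun s hs => ?_
  congr 1
  ext x
  simp only [mem_ofPred_eq]
  rw [ENNReal.ofReal_lt_iff_lt_toReal hs.1.le (hfin x)]

/-- Layer-cake formula plus Brunn–Minkowski for superlevel sets. Equal suprema make the sets for f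
and g nonempty at the same levels s < 1, which yields the stronger arithmetic-mean form. -/
theorem lintegral_prekopa_leindler_normalized {f g k : ℝ → ℝ≥0∞} (hf : Measurable f)
    (hg : Measurable g) (hk : Measurable k) (hf1 : ⨆ x, f x = 1) (hg1 : ⨆ x, g x = 1)
    {t : ℝ} (ht0 : 0 < t) (ht1 : t < 1)
    (h : ∀ x y, f x ^ (1 - t) * g y ^ t ≤ k ((1 - t) * x + t * y)) :
    ENNReal.ofReal (1 - t) * (∫⁻ x, f x) + ENNReal.ofReal t * (∫⁻ x, g x) ≤ ∫⁻ x, k x := by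
  have ht1' : 0 < 1 - t := sub_pos.2 ht1
  have hfx : ∀ x, f x ≤ 1 := fun x => hf1 ▸ le_iSup f x
  have hgx : ∀ x, g x ≤ 1 := fun x => hg1 ▸ le_iSup g x
  have hmeas : ∀ u : ℝ → ℝ≥0∞, Measurable fun s : ℝ => volume {x | ENNReal.ofReal s < u x} := by
    intro u
    refine Antitone.measurable fun s s' hs => measure_mono fun x hx => ?_
    exact (ENNReal.ofReal_le_ofReal hs).trans_lt hx
  calc ENNReal.ofReal (1 - t) * (∫⁻ x, f x) + ENNReal.ofReal t * (∫⁻ x, g x)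
      = ∫⁻ s in Ioo (0 : ℝ) 1, (ENNReal.ofReal (1 - t) * volume {x | ENNReal.ofReal s < f x} +
          ENNReal.ofReal t * volume {x | ENNReal.ofReal s < g x}) := by
        rw [lintegral_eq_lintegral_Ioo_meas_lt hf hfx, lintegral_eq_lintegral_Ioo_meas_lt hg hgx,
          lintegral_add_left ((hmeas f).const_mul _), lintegral_const_mul _ (hmeas f),
          lintegral_const_mul _ (hmeas g)]
    _ ≤ ∫⁻ s in Ioo (0 : ℝ) 1, volume {x | ENNReal.ofReal s < min (k x) 1} := by
        refine setLIntegral_mono' measurableSet_Ioo fun s hs => ?_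
        have hs1 : ENNReal.ofReal s < 1 := by simpa using hs.2
        have hne : ∀ {u : ℝ → ℝ≥0∞}, ⨆ x, u x = 1 → {x | ENNReal.ofReal s < u x}.Nonempty := by
          intro u hu
          rw [← hu] at hs1
          exact lt_iSup_iff.1 hs1
        refine volume_add_le (measurableSet_lt measurable_const hf)
          (measurableSet_lt measurable_const hg) (hne hf1) (hne hg1) ht0 ht1 fun a ha b hb => ?_
        simp only [mem_ofPred_eq] at ha hb ⊢
        refine lt_min (lt_of_lt_of_le ?_ (h a b)) hs1
        calc ENNReal.ofReal s = ENNReal.ofReal s ^ (1 - t) * ENNReal.ofReal s ^ t := by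
              rw [← ENNReal.rpow_add _ _ (by simpa using hs.1) ENNReal.ofReal_ne_top]
              simp
          _ < f a ^ (1 - t) * g b ^ t := ENNReal.mul_lt_mul (ENNReal.rpow_lt_rpow ha ht1')
              (ENNReal.rpow_lt_rpow hb ht0)
    _ = ∫⁻ x, min (k x) 1 :=
        (lintegral_eq_lintegral_Ioo_meas_lt (hk.min measurable_const) fun x => min_le_right _ _).symm
    _ ≤ ∫⁻ x, k x := lintegral_mono fun x => min_le_left _ _

theorem rpow_mul_rpow_le_weighted_add (a b : ℝ≥0∞) {t : ℝ} (ht0 : 0 < t) (ht1 : t < 1) :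
    a ^ (1 - t) * b ^ t ≤ ENNReal.ofReal (1 - t) * a + ENNReal.ofReal t * b := by
  have ht1' : 0 < 1 - t := sub_pos.2 ht1
  have h1 : ENNReal.ofReal (1 - t) ≠ 0 := by simpa using ht1
  have h2 : ENNReal.ofReal t ≠ 0 := by simpa using ht0
  rcases eq_or_ne a ∞ with rfl | ha
  · simp [ENNReal.mul_top h1]
  rcases eq_or_ne b ∞ with rfl | hb
  · simp [ENNReal.mul_top h2]
  lift a to ℝ≥0 using ha
  lift b to ℝ≥0 using hb
  have := NNReal.geom_mean_le_arith_mean2_weighted (1 - t).toNNReal t.toNNReal a b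
    (by rw [← Real.toNNReal_add ht1'.le ht0.le]; simp)
  rw [Real.coe_toNNReal _ ht1'.le, Real.coe_toNNReal _ ht0.le] at this
  rw [← ENNReal.coe_rpow_of_nonneg _ ht1'.le, ← ENNReal.coe_rpow_of_nonneg _ ht0.le]
  rw [ENNReal.ofReal, ENNReal.ofReal]
  exact_mod_cast this

theorem lintegral_prekopa_leindler_of_bounded {f g k : ℝ → ℝ≥0∞} (hf : Measurable f)
    (hg : Measurable g) (hk : Measurable k) (hf1 : ⨆ x, f x ≠ ∞) (hg1 : ⨆ x, g x ≠ ∞)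
    {t : ℝ} (ht0 : 0 < t) (ht1 : t < 1)
    (h : ∀ x y, f x ^ (1 - t) * g y ^ t ≤ k ((1 - t) * x + t * y)) :
    (∫⁻ x, f x) ^ (1 - t) * (∫⁻ x, g x) ^ t ≤ ∫⁻ x, k x := by
  have ht1' : 0 < 1 - t := sub_pos.2 ht1
  set F := ⨆ x, f x
  set G := ⨆ x, g x
  rcases eq_or_ne F 0 with hF | hF
  · have : ∀ x, f x = 0 := fun x => le_antisymm (hF ▸ le_iSup f x) bot_le
    simp [this, ht1']
  rcases eq_or_ne G 0 with hG | hG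
  · have : ∀ x, g x = 0 := fun x => le_antisymm (hG ▸ le_iSup g x) bot_le
    simp [this, ht0]
  have hFi : F * F⁻¹ = 1 := ENNReal.mul_inv_cancel hF hf1
  -- Divide f and g by their suprema; both sides scale by the same factor, and AM–GM turns the
  -- arithmetic mean back into a geometric one.
  have hGi : G * G⁻¹ = 1 := ENNReal.mul_inv_cancel hG hg1
  have key := lintegral_prekopa_leindler_normalized (hf.const_mul F⁻¹) (hg.const_mul G⁻¹)
    (hk.const_mul ((F⁻¹) ^ (1 - t) * (G⁻¹) ^ t))
    (by rw [← ENNReal.mul_iSup, mul_comm, hFi]) (by rw [← ENNReal.mul_iSup, mul_comm, hGi])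
    ht0 ht1 (fun x y => by
      rw [ENNReal.mul_rpow_of_nonneg _ _ ht1'.le, ENNReal.mul_rpow_of_nonneg _ _ ht0.le,
        mul_mul_mul_comm]
      exact mul_le_mul_right (h x y) _)
  have key2 := (rpow_mul_rpow_le_weighted_add _ _ ht0 ht1).trans key
  rw [lintegral_const_mul _ hf, lintegral_const_mul _ hg, lintegral_const_mul _ hk,
    ENNReal.mul_rpow_of_nonneg _ _ ht1'.le, ENNReal.mul_rpow_of_nonneg _ _ ht0.le,
        mul_mul_mul_comm] at key2
  refine (ENNReal.mul_le_mul_iff_right ?_ ?_).1 key2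
  · simp [hf1, hg1, hF, ht0.le]
  · refine ENNReal.mul_ne_top ?_ ?_ <;> simp [hF, hG, ht1.le, ht0.le]

/-- One-dimensional Prékopa–Leindler inequality. -/
theorem lintegral_prekopa_leindler {f g k : ℝ → ℝ≥0∞} (hf : Measurable f)
    (hg : Measurable g) (hk : Measurable k) {t : ℝ} (ht0 : 0 < t) (ht1 : t < 1)
    (h : ∀ x y, f x ^ (1 - t) * g y ^ t ≤ k ((1 - t) * x + t * y)) :
    (∫⁻ x, f x) ^ (1 - t) * (∫⁻ x, g x) ^ t ≤ ∫⁻ x, k x := by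
  have ht1' : 0 < 1 - t := sub_pos.2 ht1
  rcases eq_or_ne (∫⁻ x, f x) 0 with hF | hF
  · simp [hF, ht1']
  rcases eq_or_ne (∫⁻ x, g x) 0 with hG | hG
  · simp [hG, ht0]
  have hlim : ∀ {u : ℝ → ℝ≥0∞}, Measurable u →
      Tendsto (fun n : ℕ => ∫⁻ x, min (u x) n) atTop (𝓝 (∫⁻ x, u x)) := by
    intro u hu
    refine lintegral_tendsto_of_tendsto_of_monotone
      (fun n => (hu.min measurable_const).aemeasurable)
      (ae_of_all _ fun x n m hnm => min_le_min_left _ (by exact_mod_cast hnm))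
      (ae_of_all _ fun x => ?_)
    simpa using (tendsto_const_nhds (x := u x)).min ENNReal.tendsto_nat_nhds_top
  refine le_of_tendsto' (ENNReal.Tendsto.mul (((ENNReal.continuous_rpow_const).tendsto _).comp
    (hlim hf)) (Or.inl ?_) (((ENNReal.continuous_rpow_const).tendsto _).comp (hlim hg))
    (Or.inl ?_)) fun n => ?_
  · simp [hF, ENNReal.rpow_eq_zero_iff, ht1'.not_gt]
  · simp [hG, ENNReal.rpow_eq_zero_iff, ht0.not_gt]
  · have hb : ∀ u : ℝ → ℝ≥0∞, ⨆ x, min (u x) n ≠ ∞ := fun u =>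
      ((iSup_le fun x => min_le_right _ _).trans_lt (ENNReal.natCast_lt_top n)).ne
    refine lintegral_prekopa_leindler_of_bounded (hf.min measurable_const)
      (hg.min measurable_const) hk (hb f) (hb g) ht0 ht1 fun x y => (h x y).trans' ?_
    gcongr <;> exact min_le_left _ _

/-! ### Prékopa–Leindler with partial interpolation -/

/-- A one-dimensional Prékopa–Leindler inequality for a family of functions, some of which are
evaluated at the interpolated point and the others at the starting point. -/
theorem lintegral_rpow_mul_le_prod_lintegral {ι : Type*} (s : Finset ι) (p : ι → Prop)
    [DecidablePred p] {f g : ℝ → ℝ≥0∞} {h : ι → ℝ → ℝ≥0∞} (hf : Measurable f) (hg : Measurable g)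
    (hh : ∀ a, Measurable (h a)) (hpos : ∀ a x, h a x ≠ 0) {t : ℝ} (ht0 : 0 < t) (ht1 : t < 1)
    {C : ℕ} (hC : (s.filter p).card = C) (hC0 : 0 < C)
    (hle : ∀ x y, f x ^ (s.card - t * C) * g y ^ (t * C) ≤
      ∏ a ∈ s, h a (if p a then (1 - t) * x + t * y else x)) :
    (∫⁻ x, f x) ^ (s.card - t * C) * (∫⁻ x, g x) ^ (t * C) ≤ ∏ a ∈ s, ∫⁻ x, h a x := by
  have ht1' : 0 < 1 - t := sub_pos.2 ht1
  have hCr : (0 : ℝ) < C := by exact_mod_cast hC0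
  have hint0 : ∀ a, ∫⁻ x, h a x ≠ 0 := fun a h0 => by
    rw [lintegral_eq_zero_iff (hh a)] at h0
    obtain ⟨x, hx⟩ := h0.exists
    exact hpos a x hx
  classical
  -- An infinite factor makes the right side infinite, because positivity keeps the other integrals
  -- nonzero.
  by_cases htop : ∃ a ∈ s, ∫⁻ x, h a x = ∞
  · obtain ⟨a, ha, hatop⟩ := htop
    rw [← Finset.mul_prod_erase s _ ha, hatop, ENNReal.top_mul]
    · exact le_top
    · exact Finset.prod_ne_zero_iff.2 fun b _ => hint0 b
  push Not at htop
  set C' := (s.filter fun a => ¬ p a).card with hC'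
  have hcard : (s.card : ℝ) = C + C' := by
    rw [← hC]; exact_mod_cast (Finset.card_filter_add_card_filter_not p).symm
  set D : ℝ := s.card - t * C with hD
  have hDeq : D = C * (1 - t) + C' := by rw [hD, hcard]; ring
  have hE : 0 < C * (1 - t) := by positivity
  have hD0 : 0 < D := by rw [hDeq]; positivity
  set l : ℝ → ℝ≥0∞ := fun x => ∏ a ∈ s.filter fun a => ¬ p a, h a x with hl
  -- The factors evaluated at x are divided out of f, so that (q, g) satisfies the two-function
  -- hypothesis with k the geometric mean of the interpolated factors. Hölder then separates those
  -- factors (`h1`) and recovers f from q and the divided-out factors (`h2`), with weights C(1-t)/D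
  -- and 1/D that sum to 1.
  set q : ℝ → ℝ≥0∞ := fun x => (f x ^ D / l x) ^ (C * (1 - t))⁻¹ with hq
  have hlm : Measurable l := Finset.measurable_fun_prod _ fun a _ => hh a
  have hqm : Measurable q := ((hf.pow_const _).div hlm).pow_const _
  have hl0 : ∀ x, l x ≠ 0 := fun x => Finset.prod_ne_zero_iff.2 fun a _ => hpos a x
  have hltop : ∀ᵐ x, l x ≠ ∞ := by
    have : ∀ᵐ x, ∀ a ∈ s, h a x < ∞ := by
      rw [Finset.eventually_all]
      exact fun a ha => ae_lt_top (hh a) (htop a ha)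
    filter_upwards [this] with x hx
    exact ENNReal.prod_ne_top fun a ha => (hx a (Finset.mem_filter.1 ha).1).ne
  have hsplit : ∀ F : ι → ℝ≥0∞, ∏ a ∈ s, F a =
      (∏ a ∈ s.filter p, F a) * ∏ a ∈ s.filter (fun a => ¬ p a), F a :=
    fun F => (Finset.prod_filter_mul_prod_filter_not s p F).symm
  have h1 : (∫⁻ x, q x) ^ (C * (1 - t)) * (∫⁻ x, g x) ^ (t * C) ≤
      ∏ a ∈ s.filter p, ∫⁻ x, h a x := by
    have hPL := lintegral_prekopa_leindler hqm hg
      (k := fun z => ∏ a ∈ s.filter p, h a z ^ (C : ℝ)⁻¹)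
      (Finset.measurable_fun_prod _ fun a _ => (hh a).pow_const _) ht0 ht1 fun x y => by
        have hxy := hle x y
        rw [hsplit, Finset.prod_congr rfl fun a ha => by rw [if_pos (Finset.mem_filter.1 ha).2],
          Finset.prod_congr (s₁ := s.filter fun a => ¬ p a) rfl fun a ha => by
            rw [if_neg (Finset.mem_filter.1 ha).2]] at hxy
        have hdiv := ENNReal.rpow_le_rpow (ENNReal.div_le_of_le_mul hxy) (inv_nonneg.2 hCr.le)
        rw [ENNReal.prod_rpow_of_nonneg (inv_nonneg.2 hCr.le)]
        refine le_trans (le_of_eq ?_) hdiv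
        rw [ENNReal.mul_div_right_comm, ENNReal.mul_rpow_of_nonneg _ _ (inv_nonneg.2 hCr.le), hq,
          ← ENNReal.rpow_mul, ← ENNReal.rpow_mul]
        congr 2 <;> field_simp
    have hH := hPL.trans (ENNReal.lintegral_prod_norm_pow_le _ (fun a _ => (hh a).aemeasurable)
      (p := fun _ => (C : ℝ)⁻¹) (by simp [hC, hCr.ne']) fun _ _ => inv_nonneg.2 hCr.le)
    rw [ENNReal.prod_rpow_of_nonneg (inv_nonneg.2 hCr.le)] at hH
    have := ENNReal.rpow_le_rpow hH hCr.le
    rw [← ENNReal.rpow_mul, inv_mul_cancel₀ hCr.ne', ENNReal.rpow_one,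
      ENNReal.mul_rpow_of_nonneg _ _ hCr.le, ← ENNReal.rpow_mul, ← ENNReal.rpow_mul] at this
    rwa [mul_comm (C : ℝ)]
  have h2 : (∫⁻ x, f x) ^ D ≤
      (∫⁻ x, q x) ^ (C * (1 - t)) * ∏ a ∈ s.filter (fun a => ¬ p a), ∫⁻ x, h a x := by
    have hfe : ∫⁻ x, f x = ∫⁻ x, q x ^ (C * (1 - t) / D) *
        ∏ a ∈ s.filter (fun a => ¬ p a), h a x ^ D⁻¹ := by
      refine lintegral_congr_ae ?_
      filter_upwards [hltop] with x hx
      rw [ENNReal.prod_rpow_of_nonneg (inv_nonneg.2 hD0.le), hq, ← ENNReal.rpow_mul,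
        show (C * (1 - t))⁻¹ * (C * (1 - t) / D) = D⁻¹ by field_simp,
        ← ENNReal.mul_rpow_of_nonneg _ _ (inv_nonneg.2 hD0.le)]
      change f x = (f x ^ D / l x * l x) ^ D⁻¹
      rw [ENNReal.div_mul_cancel (hl0 x) hx, ← ENNReal.rpow_mul, mul_inv_cancel₀ hD0.ne',
        ENNReal.rpow_one]
    have hH := hfe.le.trans (ENNReal.lintegral_mul_prod_norm_pow_le _ hqm.aemeasurable
      (fun a _ => (hh a).aemeasurable) (C * (1 - t) / D) (p := fun _ => D⁻¹) (by
        rw [Finset.sum_const, nsmul_eq_mul, ← hC', ← div_eq_mul_inv, ← add_div, ← hDeq,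
          div_self hD0.ne']) (by positivity) fun _ _ => inv_nonneg.2 hD0.le)
    rw [ENNReal.prod_rpow_of_nonneg (inv_nonneg.2 hD0.le)] at hH
    have := ENNReal.rpow_le_rpow hH hD0.le
    rwa [ENNReal.mul_rpow_of_nonneg _ _ hD0.le, ← ENNReal.rpow_mul, ← ENNReal.rpow_mul,
      inv_mul_cancel₀ hD0.ne', div_mul_cancel₀ _ hD0.ne', ENNReal.rpow_one] at this
  calc (∫⁻ x, f x) ^ D * (∫⁻ x, g x) ^ (t * C)
      ≤ ((∫⁻ x, q x) ^ (C * (1 - t)) * ∏ a ∈ s.filter (fun a => ¬ p a), ∫⁻ x, h a x) *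
          (∫⁻ x, g x) ^ (t * C) := mul_le_mul_left h2 _
    _ = ((∫⁻ x, q x) ^ (C * (1 - t)) * (∫⁻ x, g x) ^ (t * C)) *
          ∏ a ∈ s.filter (fun a => ¬ p a), ∫⁻ x, h a x := by ring
    _ ≤ _ := by
      rw [hsplit]
      exact mul_le_mul_left h1 _

/-- The point `x + t (y - x)_A`. -/
def interp {δ : Type*} (A : Set δ) [DecidablePred (· ∈ A)] (t : ℝ) (x y : δ → ℝ) : δ → ℝ :=
  fun j => if j ∈ A then (1 - t) * x j + t * y j else x j

theorem update_interp {δ : Type*} [DecidableEq δ] (A : Set δ) [DecidablePred (· ∈ A)] (t : ℝ)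
    (x y : δ → ℝ) (i : δ) (u v : ℝ) :
    interp A t (Function.update x i u) (Function.update y i v) =
      Function.update (interp A t x y) i (if i ∈ A then (1 - t) * u + t * v else u) := by
  funext j
  rcases eq_or_ne j i with rfl | hj
  · simp [interp]
  · simp [interp, hj]

/-- Integrate one coordinate at a time. For coordinate i the family splits by whether i ∈ A a; the
count C is the same for every i, so the exponents are reproduced at each step. Positivity is carried
along because the one-dimensional inequality needs it. -/
theorem lmarginal_rpow_mul_le_prod_lmarginal {ι δ : Type*} [Fintype δ] [DecidableEq δ]
    (s : Finset ι) (A : ι → Set δ) [∀ a, DecidablePred (· ∈ A a)] {f g : (δ → ℝ) → ℝ≥0∞}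
    {h : ι → (δ → ℝ) → ℝ≥0∞}
    (hf : Measurable f) (hg : Measurable g) (hh : ∀ a, Measurable (h a))
    (hpos : ∀ a x, h a x ≠ 0) {t : ℝ} (ht0 : 0 < t) (ht1 : t < 1) {C : ℕ}
    (hC : ∀ j, (s.filter fun a => j ∈ A a).card = C) (hC0 : 0 < C)
    (hle : ∀ x y, f x ^ (s.card - t * C) * g y ^ (t * C) ≤ ∏ a ∈ s, h a (interp (A a) t x y))
    (r : Finset δ) (x y : δ → ℝ) :
    (∫⋯∫⁻_r, f) x ^ (s.card - t * C) * (∫⋯∫⁻_r, g) y ^ (t * C) ≤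
      ∏ a ∈ s, (∫⋯∫⁻_r, h a) (interp (A a) t x y) ∧ ∀ a x, (∫⋯∫⁻_r, h a) x ≠ 0 := by
  induction r using Finset.induction generalizing x y with
  | empty => simpa using ⟨hle x y, hpos⟩
  | insert i r hi ih =>
    have hpos' : ∀ a x, (∫⋯∫⁻_r, h a) x ≠ 0 := (ih x y).2
    have hm : ∀ {u : (δ → ℝ) → ℝ≥0∞}, Measurable u → ∀ x : δ → ℝ,
        Measurable fun v => (∫⋯∫⁻_r, u) (Function.update x i v) := fun hu x =>
      (hu.lmarginal _).comp (measurable_update x)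
    refine ⟨?_, fun a x h0 => ?_⟩
    · simp only [lmarginal_insert _ hf hi, lmarginal_insert _ hg hi, lmarginal_insert _ (hh _) hi]
      refine lintegral_rpow_mul_le_prod_lintegral s (fun a => i ∈ A a) (hm hf x) (hm hg y)
        (fun a => hm (hh a) _) (fun a v => hpos' a _) ht0 ht1 (hC i) hC0 fun u v => ?_
      refine (ih _ _).1.trans (le_of_eq (Finset.prod_congr rfl fun a _ => ?_))
      rw [update_interp]
    · rw [lmarginal_insert _ (hh a) hi, lintegral_eq_zero_iff (hm (hh a) x)] at h0
      obtain ⟨v, hv⟩ := h0.exists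
      exact hpos' a _ hv

/-- Prékopa–Leindler inequality for a family of functions evaluated at partially interpolated
points, when every coordinate is interpolated equally often. -/
theorem lintegral_pi_rpow_mul_le_prod_lintegral {ι δ : Type*} [Fintype δ]
    (s : Finset ι) (A : ι → Set δ) [∀ a, DecidablePred (· ∈ A a)] {f g : (δ → ℝ) → ℝ≥0∞}
    {h : ι → (δ → ℝ) → ℝ≥0∞}
    (hf : Measurable f) (hg : Measurable g) (hh : ∀ a, Measurable (h a))
    (hpos : ∀ a x, h a x ≠ 0) {t : ℝ} (ht0 : 0 < t) (ht1 : t < 1) {C : ℕ}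
    (hC : ∀ j, (s.filter fun a => j ∈ A a).card = C) (hC0 : 0 < C)
    (hle : ∀ x y, f x ^ (s.card - t * C) * g y ^ (t * C) ≤ ∏ a ∈ s, h a (interp (A a) t x y)) :
    (∫⁻ x, f x) ^ (s.card - t * C) * (∫⁻ x, g x) ^ (t * C) ≤ ∏ a ∈ s, ∫⁻ x, h a x := by
  classical
  have := (lmarginal_rpow_mul_le_prod_lmarginal s A hf hg hh hpos ht0 ht1 hC hC0 hle
    Finset.univ 0 0).1
  simp only [lmarginal_univ] at this
  exact this

/-! ### Quadratic bounds from smoothness and strong convexity -/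

section Smooth
open scoped RealInnerProductSpace

variable {E : Type*} [NormedAddCommGroup E] [InnerProductSpace ℝ E] [CompleteSpace E]

theorem hasDerivAt_comp_line {U : E → ℝ} (hU : Differentiable ℝ U) (x v : E) (s : ℝ) :
    HasDerivAt (fun s : ℝ => U (x + s • v)) ⟪gradient U (x + s • v), v⟫ s := by
  have h1 : HasDerivAt (fun s : ℝ => x + s • v) v s := by
    simpa using ((hasDerivAt_id s).smul_const v).const_add x
  have h2 := ((hU (x + s • v)).hasGradientAt.hasFDerivAt).comp_hasDerivAt s h1
  simpa [Function.comp_def] using h2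

/-- Descent lemma. -/
theorem le_quadratic_of_lipschitz_gradient {U : E → ℝ} (hU : Differentiable ℝ U) {L : ℝ≥0}
    (hL : LipschitzWith L (gradient U)) (x v : E) :
    U (x + v) ≤ U x + ⟪gradient U x, v⟫ + L / 2 * ‖v‖ ^ 2 := by
  set φ : ℝ → ℝ := fun s => U (x + s • v) - s * ⟪gradient U x, v⟫ - L / 2 * ‖v‖ ^ 2 * s ^ 2
  have hd : ∀ s, HasDerivAt φ (⟪gradient U (x + s • v), v⟫ - 1 * ⟪gradient U x, v⟫ -
      L / 2 * ‖v‖ ^ 2 * (2 * s)) s := fun s => by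
    refine ((hasDerivAt_comp_line hU x v s).sub ((hasDerivAt_id s).mul_const _)).sub
      (HasDerivAt.const_mul _ ?_)
    simpa using hasDerivAt_pow 2 s
  have hanti : AntitoneOn φ (Icc 0 1) := by
    refine antitoneOn_of_hasDerivWithinAt_nonpos (convex_Icc 0 1)
      (fun s _ => (hd s).continuousAt.continuousWithinAt)
      (fun s _ => (hd s).hasDerivWithinAt) fun s hs => ?_
    rw [interior_Icc] at hs
    have h1 : ⟪gradient U (x + s • v) - gradient U x, v⟫ ≤ L * (s * ‖v‖) * ‖v‖ := by
      refine (real_inner_le_norm _ _).trans (mul_le_mul_of_nonneg_right ?_ (norm_nonneg _))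
      have := hL.norm_sub_le (x + s • v) x
      rwa [add_sub_cancel_left, norm_smul, Real.norm_of_nonneg hs.1.le] at this
    rw [inner_sub_left] at h1
    nlinarith
  have := hanti (by simp) (by simp) zero_le_one
  simp only [φ, one_smul, zero_smul, add_zero] at this
  linarith

/-- Along s ↦ x + s v, the convex function U - λ/2‖·‖² has derivative at 0 at most its slope from 0
to 1; the quadratic terms are then expanded. -/
theorem quadratic_le_of_strongly_convex {U : E → ℝ} (hU : Differentiable ℝ U) {lam : ℝ}
    (hlam : ConvexOn ℝ univ fun x => U x - lam / 2 * ‖x‖ ^ 2) (x v : E) :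
    U x + ⟪gradient U x, v⟫ + lam / 2 * ‖v‖ ^ 2 ≤ U (x + v) := by
  set V : E → ℝ := fun x => U x - lam / 2 * ‖x‖ ^ 2
  have hexp : ∀ s : ℝ, ‖x + s • v‖ ^ 2 = ‖x‖ ^ 2 + s * (2 * ⟪x, v⟫) + s ^ 2 * ‖v‖ ^ 2 := fun s => by
    rw [norm_add_sq_real, norm_smul, inner_smul_right, mul_pow, Real.norm_eq_abs, sq_abs]
    ring
  have hconv : ConvexOn ℝ univ fun s : ℝ => V (x + s • v) := by
    have := hlam.comp_affineMap (AffineMap.lineMap x (x + v) : ℝ →ᵃ[ℝ] E)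
    simpa [Function.comp_def, AffineMap.lineMap_apply, V, add_comm] using this
  have hd : HasDerivAt (fun s : ℝ => V (x + s • v)) (⟪gradient U x, v⟫ - lam * ⟪x, v⟫) 0 := by
    have h1 := hasDerivAt_comp_line hU x v 0
    have h2 : HasDerivAt (fun s : ℝ => lam / 2 * ‖x + s • v‖ ^ 2) (lam / 2 * (2 * ⟪x, v⟫)) 0 := by
      simp only [hexp]
      refine HasDerivAt.const_mul _ ?_
      have := (((hasDerivAt_id (0 : ℝ)).mul_const (2 * ⟪x, v⟫)).const_add (‖x‖ ^ 2)).add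
        ((hasDerivAt_pow 2 (0 : ℝ)).mul_const (‖v‖ ^ 2))
      convert! this using 1
      simp
    have := h1.sub h2
    simp only [zero_smul, add_zero] at this
    convert! this using 1
    ring
  have hs := hconv.le_slope_of_hasDerivAt (mem_univ 0) (mem_univ 1) zero_lt_one hd
  have h1 := hexp 1
  simp only [one_smul] at h1
  simp only [slope_def_field, V, one_smul, zero_smul, add_zero, sub_zero, div_one, h1] at hs
  linarith

/-- The upper and lower quadratic bounds are compared at one nonzero increment; nontriviality
supplies it. -/
theorem strong_convexity_le_lipschitz [Nontrivial E] {U : E → ℝ} (hU : Differentiable ℝ U)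
    {L : ℝ≥0} (hL : LipschitzWith L (gradient U)) {lam : ℝ}
    (hlam : ConvexOn ℝ univ fun x => U x - lam / 2 * ‖x‖ ^ 2) : lam ≤ L := by
  obtain ⟨v, hv⟩ := exists_ne (0 : E)
  have h1 := le_quadratic_of_lipschitz_gradient hU hL 0 v
  have h2 := quadratic_le_of_strongly_convex hU hlam 0 v
  have h3 : 0 < ‖v‖ ^ 2 := by positivity
  nlinarith

end Smooth

/-! ### The potential at partially interpolated points -/

/-- Each coordinate moves for exactly C indices, so with V = y - x the increments have total
first-order term tC⟨∇U(x), V⟩ and total squared norm t²C‖V‖². The smoothness error tC·(tL/2)‖V‖² is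
at most the strong-convexity gain tC·(λ/2)‖V‖² since tL ≤ λ. -/
theorem sum_interp_le {ι δ : Type*} [Fintype δ] (s : Finset ι) (A : ι → Set δ)
    [∀ a, DecidablePred (· ∈ A a)] {U : EuclideanSpace ℝ δ → ℝ} (hU : Differentiable ℝ U)
    {L : ℝ≥0} (hL : LipschitzWith L (gradient U)) {lam : ℝ}
    (hlam : ConvexOn ℝ univ fun x => U x - lam / 2 * ‖x‖ ^ 2) {t : ℝ} (ht0 : 0 ≤ t)
    (htL : t * L ≤ lam) {C : ℕ} (hC : ∀ j, (s.filter fun a => j ∈ A a).card = C) (x y : δ → ℝ) :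
    ∑ a ∈ s, U (WithLp.toLp 2 (interp (A a) t x y)) ≤
      (s.card - t * C) * U (WithLp.toLp 2 x) + t * C * U (WithLp.toLp 2 y) := by
  set X : EuclideanSpace ℝ δ := WithLp.toLp 2 x with hX
  set V : EuclideanSpace ℝ δ := WithLp.toLp 2 y - X with hV
  set v : ι → EuclideanSpace ℝ δ := fun a => WithLp.toLp 2 (interp (A a) t x y) - X
  have hvj : ∀ a j, v a j = if j ∈ A a then t * V j else 0 := fun a j => by
    simp only [v, hV, hX, PiLp.sub_apply, interp]
    split_ifs <;> ring
  have hcount : ∀ (j : δ) (c : ℝ), (∑ a ∈ s, if j ∈ A a then c else 0) = C * c := fun j c => by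
    rw [← Finset.sum_filter, Finset.sum_const, hC, nsmul_eq_mul]
  have h1 : ∑ a ∈ s, inner ℝ (gradient U X) (v a) = t * C * inner ℝ (gradient U X) V := by
    simp only [PiLp.inner_apply, hvj]
    rw [Finset.sum_comm, Finset.mul_sum]
    refine Finset.sum_congr rfl fun j _ => ?_
    simp only [RCLike.inner_apply, conj_trivial, ite_mul, zero_mul]
    rw [hcount]
    ring
  have h2 : ∑ a ∈ s, ‖v a‖ ^ 2 = t ^ 2 * C * ‖V‖ ^ 2 := by
    simp only [EuclideanSpace.real_norm_sq_eq, hvj]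
    rw [Finset.sum_comm, Finset.mul_sum]
    refine Finset.sum_congr rfl fun j _ => ?_
    simp only [ite_pow, ne_eq, OfNat.ofNat_ne_zero, not_false_eq_true, zero_pow]
    rw [hcount]
    ring
  have h3 : ∀ a ∈ s, U (WithLp.toLp 2 (interp (A a) t x y)) ≤
      U X + inner ℝ (gradient U X) (v a) + L / 2 * ‖v a‖ ^ 2 := fun a _ => by
    have := le_quadratic_of_lipschitz_gradient hU hL X (v a)
    rwa [add_sub_cancel] at this
  have h4 := quadratic_le_of_strongly_convex hU hlam X V
  rw [hV, add_sub_cancel, ← hV] at h4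
  refine (Finset.sum_le_sum h3).trans ?_
  rw [Finset.sum_add_distrib, Finset.sum_add_distrib, ← Finset.mul_sum, h1, h2, Finset.sum_const,
    nsmul_eq_mul]
  have h5 : 0 ≤ t * C * (lam - t * L) * (‖V‖ ^ 2 / 2) :=
    mul_nonneg (mul_nonneg (by positivity) (sub_nonneg.2 htL)) (by positivity)
  have h6 := mul_le_mul_of_nonneg_left h4 (by positivity : 0 ≤ t * C)
  nlinarith

theorem card_filter_mem_powersetCard {M ℓ : ℕ} (hℓ : 1 ≤ ℓ) (m : Fin M) :
    (((Finset.univ : Finset (Fin M)).powersetCard ℓ).filter fun S => m ∈ S).card =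
      (M - 1).choose (ℓ - 1) := by
  have h := Finset.card_filter_add_card_filter_not
    (s := (Finset.univ : Finset (Fin M)).powersetCard ℓ) (fun S => m ∈ S)
  have h2 : ((Finset.univ : Finset (Fin M)).powersetCard ℓ).filter (fun S => ¬ m ∈ S) =
      (Finset.univ.erase m).powersetCard ℓ := by
    ext S
    simp only [Finset.mem_filter, Finset.mem_powersetCard, Finset.subset_univ, true_and,
      Finset.subset_erase]
    tauto
  rw [h2, Finset.card_powersetCard, Finset.card_powersetCard, Finset.card_erase_of_mem
    (Finset.mem_univ m), Finset.card_univ, Fintype.card_fin] at h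
  have hM : 0 < M := m.pos
  obtain ⟨M, rfl⟩ := Nat.exists_eq_add_of_le' hM
  obtain ⟨ℓ, rfl⟩ := Nat.exists_eq_add_of_le' hℓ
  rw [Nat.choose_succ_succ'] at h
  simp only [Nat.add_sub_cancel] at h ⊢
  omega

/-! ### From Prékopa–Leindler to the entropy inequality -/

theorem lintegral_withDensity_euclidean {δ : Type*} [Fintype δ] {w F : EuclideanSpace ℝ δ → ℝ≥0∞}
    (hw : Measurable w) (hF : Measurable F) :
    ∫⁻ x, F x ∂(volume.withDensity w) =
      ∫⁻ x : δ → ℝ, F (WithLp.toLp 2 x) * w (WithLp.toLp 2 x) := by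
  rw [lintegral_withDensity_eq_lintegral_mul _ hw hF,
    ← (PiLp.volume_preserving_toLp δ).lintegral_comp (hw.mul hF)]
  simp only [Pi.mul_apply, mul_comm]

section
variable {ι δ : Type*} [Fintype δ] (s : Finset ι) (A : ι → Set δ)
  [∀ a, DecidablePred (· ∈ A a)] {U : EuclideanSpace ℝ δ → ℝ} {π : Measure (EuclideanSpace ℝ δ)}
  {t : ℝ} {C : ℕ}

theorem lintegral_prod_rpow_le_prod_lintegral_of_pos
    (hU : Continuous U) (hπ : π = volume.withDensity fun x => ENNReal.ofReal (Real.exp (-U x)))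
    [IsProbabilityMeasure π] (ht0 : 0 < t) (ht1 : t < 1)
    (hC : ∀ j, (s.filter fun a => j ∈ A a).card = C) (hC0 : 0 < C)
    (hc : 0 < s.card - t * C)
    (hUle : ∀ x y : δ → ℝ, ∑ a ∈ s, U (WithLp.toLp 2 (interp (A a) t x y)) ≤
      (s.card - t * C) * U (WithLp.toLp 2 x) + t * C * U (WithLp.toLp 2 y))
    {φ : ι → EuclideanSpace ℝ δ → ℝ≥0∞} (hφ : ∀ a, Measurable (φ a)) (hpos : ∀ a x, φ a x ≠ 0)
    (hφA : ∀ a x y, φ a (WithLp.toLp 2 (interp (A a) t x y)) = φ a (WithLp.toLp 2 x)) :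
    (∫⁻ x, (∏ a ∈ s, φ a x) ^ (s.card - t * C)⁻¹ ∂π) ^ (s.card - t * C) ≤
      ∏ a ∈ s, ∫⁻ x, φ a x ∂π := by
  set c : ℝ := s.card - t * C
  set w : EuclideanSpace ℝ δ → ℝ≥0∞ := fun x => ENNReal.ofReal (Real.exp (-U x)) with hw
  have hwm : Measurable w := by fun_prop
  have hlp : Measurable (WithLp.toLp 2 : (δ → ℝ) → EuclideanSpace ℝ δ) :=
    WithLp.measurable_toLp 2 _
  have hwpow : ∀ (x : EuclideanSpace ℝ δ) (r : ℝ),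
      w x ^ r = ENNReal.ofReal (Real.exp (-(r * U x))) := fun x r => by
    rw [hw, ENNReal.ofReal_rpow_of_pos (Real.exp_pos _), ← Real.exp_mul]
    ring_nf
  have hg1 : ∫⁻ x : δ → ℝ, w (WithLp.toLp 2 x) = 1 := by
    have := lintegral_withDensity_euclidean hwm (measurable_const (a := (1 : ℝ≥0∞)))
    rw [← hπ] at this
    simpa using this.symm
  have hPm : Measurable fun x => (∏ a ∈ s, φ a x) ^ c⁻¹ :=
    (Finset.measurable_fun_prod _ fun a _ => hφ a).pow_const _
  -- Raising f to the power c restores ∏ φ_a, which cancels against the right side because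
  -- interpolation leaves each φ_a unchanged; what remains is `hUle` exponentiated. The function g
  -- has integral 1.
  have key := lintegral_pi_rpow_mul_le_prod_lintegral s A
    (f := fun x => (∏ a ∈ s, φ a (WithLp.toLp 2 x)) ^ c⁻¹ * w (WithLp.toLp 2 x))
    (g := fun x => w (WithLp.toLp 2 x))
    (h := fun a x => φ a (WithLp.toLp 2 x) * w (WithLp.toLp 2 x))
    ((hPm.mul hwm).comp hlp) (hwm.comp hlp) (fun a => ((hφ a).mul hwm).comp hlp)
    (fun a x => mul_ne_zero (hpos a _) (by simp [hw, Real.exp_pos])) ht0 ht1 hC hC0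
    fun x y => by
      rw [ENNReal.mul_rpow_of_nonneg _ _ hc.le, ← ENNReal.rpow_mul, inv_mul_cancel₀ hc.ne',
        ENNReal.rpow_one, Finset.prod_mul_distrib, mul_assoc]
      simp only [hφA]
      refine mul_le_mul_right ?_ _
      rw [hwpow, hwpow, ← ENNReal.ofReal_mul (Real.exp_pos _).le, ← Real.exp_add, hw,
        ← ENNReal.ofReal_prod_of_nonneg fun _ _ => (Real.exp_pos _).le, ← Real.exp_sum]
      refine ENNReal.ofReal_le_ofReal (Real.exp_le_exp.2 ?_)
      rw [Finset.sum_neg_distrib]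
      linarith [hUle x y]
  rw [hg1, ENNReal.one_rpow, mul_one] at key
  rw [hπ, lintegral_withDensity_euclidean hwm hPm]
  refine key.trans (le_of_eq (Finset.prod_congr rfl fun a _ => ?_))
  rw [lintegral_withDensity_euclidean hwm (hφ a)]

theorem lintegral_prod_rpow_le_one
    (hU : Continuous U) (hπ : π = volume.withDensity fun x => ENNReal.ofReal (Real.exp (-U x)))
    [IsProbabilityMeasure π] (ht0 : 0 < t) (ht1 : t < 1)
    (hC : ∀ j, (s.filter fun a => j ∈ A a).card = C) (hC0 : 0 < C)
    (hc : 0 < s.card - t * C)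
    (hUle : ∀ x y : δ → ℝ, ∑ a ∈ s, U (WithLp.toLp 2 (interp (A a) t x y)) ≤
      (s.card - t * C) * U (WithLp.toLp 2 x) + t * C * U (WithLp.toLp 2 y))
    {φ : ι → EuclideanSpace ℝ δ → ℝ≥0∞} (hφ : ∀ a, Measurable (φ a))
    (hφA : ∀ a x y, φ a (WithLp.toLp 2 (interp (A a) t x y)) = φ a (WithLp.toLp 2 x))
    (hφ1 : ∀ a, ∫⁻ x, φ a x ∂π ≤ 1) :
    ∫⁻ x, (∏ a ∈ s, φ a x) ^ (s.card - t * C)⁻¹ ∂π ≤ 1 := by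
  have hbound : ∀ n : ℕ, (∫⁻ x, (∏ a ∈ s, φ a x) ^ (s.card - t * C)⁻¹ ∂π) ^ (s.card - t * C) ≤
      (1 + (n : ℝ≥0∞)⁻¹) ^ s.card := fun n => by
    -- Adding 1/n restores strict positivity and costs at most 1/n in each integral; at n = 0 the
    -- shift is ∞, which is still allowed.
    have h := lintegral_prod_rpow_le_prod_lintegral_of_pos s A hU hπ ht0 ht1 hC hC0 hc hUle
      (φ := fun a x => φ a x + (n : ℝ≥0∞)⁻¹) (fun a => (hφ a).add_const _) (by simp)
      (fun a x y => by simp only [hφA])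
    refine (ENNReal.rpow_le_rpow (lintegral_mono fun x => ENNReal.rpow_le_rpow
      (Finset.prod_le_prod' fun a _ => le_self_add) (inv_nonneg.2 hc.le)) hc.le).trans
      (h.trans ?_)
    refine Finset.prod_le_pow_card _ _ _ fun a _ => ?_
    rw [lintegral_add_left (hφ a)]
    simpa using add_le_add_left (hφ1 a) _
  have hlim : Tendsto (fun n : ℕ => (1 + (n : ℝ≥0∞)⁻¹) ^ s.card) atTop (𝓝 1) := by
    have h1 : Tendsto (fun n : ℕ => 1 + (n : ℝ≥0∞)⁻¹) atTop (𝓝 (1 + 0)) :=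
      tendsto_const_nhds.add ENNReal.tendsto_inv_nat_nhds_zero
    simpa [Function.comp_def] using ((ENNReal.continuous_pow s.card).tendsto _).comp h1
  have := ge_of_tendsto' hlim hbound
  by_contra! h
  exact absurd (ENNReal.one_lt_rpow h hc) this.not_gt

end

/-- Gibbs variational inequality. -/
theorem integral_log_le_toReal_klDiv {α : Type*} [MeasurableSpace α] {μ ν : Measure α}
    [IsProbabilityMeasure μ] [IsProbabilityMeasure ν] (hμν : μ ≪ ν)
    (hint : Integrable (llr μ ν) μ) {G : α → ℝ≥0∞} (hG : Measurable G) (hG1 : ∫⁻ x, G x ∂ν ≤ 1)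
    (hG0 : ∀ᵐ x ∂μ, G x ≠ 0) (hGtop : ∀ᵐ x ∂μ, G x ≠ ∞)
    (hGint : Integrable (fun x => Real.log (G x).toReal) μ) :
    ∫ x, Real.log (G x).toReal ∂μ ≤ (klDiv μ ν).toReal := by
  rw [toReal_klDiv_of_measure_eq hμν (by simp)]
  -- Change of measure gives ∫ R dμ ≤ ∫ G dν ≤ 1, and log R ≤ R - 1 then concludes.
  set R : α → ℝ≥0∞ := fun x => G x / μ.rnDeriv ν x with hR
  have hRm : Measurable R := hG.div (Measure.measurable_rnDeriv μ ν)
  have hpos : ∀ᵐ x ∂μ, 0 < μ.rnDeriv ν x := Measure.rnDeriv_pos hμν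
  have htop : ∀ᵐ x ∂μ, μ.rnDeriv ν x < ∞ := hμν.ae_le (Measure.rnDeriv_lt_top μ ν)
  have hR1 : ∫⁻ x, R x ∂μ ≤ 1 := by
    rw [← lintegral_rnDeriv_mul hμν hRm.aemeasurable]
    refine (lintegral_mono fun x => ?_).trans hG1
    exact ENNReal.mul_div_le
  have hRtop : ∀ᵐ x ∂μ, R x < ∞ :=
    ae_lt_top hRm (hR1.trans_lt ENNReal.one_lt_top).ne
  have hRint : Integrable (fun x => (R x).toReal) μ :=
    integrable_toReal_of_lintegral_ne_top hRm.aemeasurable (hR1.trans_lt ENNReal.one_lt_top).ne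
  have hRle : ∫ x, (R x).toReal ∂μ ≤ 1 := by
    rw [integral_toReal hRm.aemeasurable hRtop]
    exact ENNReal.toReal_le_of_le_ofReal zero_le_one (by simpa using hR1)
  have hle : ∫ x, (Real.log (G x).toReal - llr μ ν x) ∂μ ≤ ∫ x, ((R x).toReal - 1) ∂μ := by
    refine integral_mono_ae (hGint.sub hint) (hRint.sub (integrable_const _)) ?_
    filter_upwards [hpos, htop, hG0, hGtop] with x h1 h2 h3 h4
    have hg : 0 < (G x).toReal := ENNReal.toReal_pos h3 h4
    have hr : 0 < (μ.rnDeriv ν x).toReal := ENNReal.toReal_pos h1.ne' h2.ne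
    simp only [llr, hR, ENNReal.toReal_div]
    rw [← Real.log_div hg.ne' hr.ne']
    exact Real.log_le_sub_one_of_pos (div_pos hg hr)
  rw [integral_sub hGint hint, integral_sub hRint (integrable_const _)] at hle
  simp only [integral_const, probReal_univ, smul_eq_mul, mul_one] at hle
  linarith

/-- The Gibbs variational inequality is tested with (∏ φ_a)^{1/c}, where φ_a is the density of the
image measures pulled back by `T a`; its μ-integrated logarithm is c⁻¹ times the sum of the image
entropies. -/
theorem sum_klDiv_map_le {ι δ : Type*} [Fintype δ] (s : Finset ι) (A : ι → Set δ)
    [∀ a, DecidablePred (· ∈ A a)] {U : EuclideanSpace ℝ δ → ℝ}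
    {π μ : Measure (EuclideanSpace ℝ δ)} {t : ℝ} {C : ℕ} {β : ι → Type*}
    [∀ a, MeasurableSpace (β a)] {T : ∀ a, EuclideanSpace ℝ δ → β a}
    (hU : Continuous U) (hπ : π = volume.withDensity fun x => ENNReal.ofReal (Real.exp (-U x)))
    [IsProbabilityMeasure π] [IsProbabilityMeasure μ] (ht0 : 0 < t) (ht1 : t < 1)
    (hC : ∀ j, (s.filter fun a => j ∈ A a).card = C) (hC0 : 0 < C)
    (hc : 0 < s.card - t * C)
    (hUle : ∀ x y : δ → ℝ, ∑ a ∈ s, U (WithLp.toLp 2 (interp (A a) t x y)) ≤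
      (s.card - t * C) * U (WithLp.toLp 2 x) + t * C * U (WithLp.toLp 2 y))
    (hT : ∀ a, Measurable (T a))
    (hTA : ∀ a x y, T a (WithLp.toLp 2 (interp (A a) t x y)) = T a (WithLp.toLp 2 x)) :
    ∑ a ∈ s, klDiv (μ.map (T a)) (π.map (T a)) ≤
      ENNReal.ofReal (s.card - t * C) * klDiv μ π := by
  rcases eq_or_ne (klDiv μ π) ∞ with htop | hfin
  · rw [htop, ENNReal.mul_top (by simpa using hc)]
    exact le_top
  obtain ⟨hμπ, hint⟩ := klDiv_ne_top_iff.1 hfin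
  have hprobμ : ∀ a, IsProbabilityMeasure (μ.map (T a)) := fun a =>
    Measure.isProbabilityMeasure_map (hT a).aemeasurable
  have hprobπ : ∀ a, IsProbabilityMeasure (π.map (T a)) := fun a =>
    Measure.isProbabilityMeasure_map (hT a).aemeasurable
  have hac : ∀ a, μ.map (T a) ≪ π.map (T a) := fun a => hμπ.map (hT a)
  have hinta : ∀ a, Integrable (llr (μ.map (T a)) (π.map (T a))) (μ.map (T a)) := fun a =>
    integrable_llr_map hμπ (hT a) hint
  have hintT : ∀ a, Integrable (fun x => llr (μ.map (T a)) (π.map (T a)) (T a x)) μ := fun a =>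
    (hinta a).comp_measurable (hT a)
  have hKL : ∀ a, ∫ x, llr (μ.map (T a)) (π.map (T a)) (T a x) ∂μ =
      (klDiv (μ.map (T a)) (π.map (T a))).toReal := fun a => by
    rw [toReal_klDiv_of_measure_eq (hac a) (by simp),
      integral_map (hT a).aemeasurable (measurable_llr _ _).aestronglyMeasurable]
  set c : ℝ := s.card - t * C
  set φ : ι → EuclideanSpace ℝ δ → ℝ≥0∞ := fun a x => (μ.map (T a)).rnDeriv (π.map (T a)) (T a x)
    with hφ
  have hφm : ∀ a, Measurable (φ a) := fun a => (Measure.measurable_rnDeriv _ _).comp (hT a)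
  have hφ1 : ∀ a, ∫⁻ x, φ a x ∂π ≤ 1 := fun a => by
    rw [← lintegral_map (Measure.measurable_rnDeriv _ _) (hT a),
      Measure.lintegral_rnDeriv (hac a)]
    simp
  have hG1 := lintegral_prod_rpow_le_one s A hU hπ ht0 ht1 hC hC0 hc hUle hφm
    (fun a x y => by simp only [hφ, hTA]) hφ1
  have hφ0 : ∀ᵐ x ∂μ, ∀ a ∈ s, φ a x ≠ 0 ∧ φ a x ≠ ∞ := by
    rw [Finset.eventually_all]
    intro a _
    refine ae_of_ae_map (hT a).aemeasurable (p := fun z =>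
      (μ.map (T a)).rnDeriv (π.map (T a)) z ≠ 0 ∧ (μ.map (T a)).rnDeriv (π.map (T a)) z ≠ ∞) ?_
    filter_upwards [Measure.rnDeriv_pos (hac a), (hac a).ae_le
      (Measure.rnDeriv_lt_top (μ.map (T a)) (π.map (T a)))]
      with z h1 h2 using ⟨h1.ne', h2.ne⟩
  have hlog : (fun x => Real.log (((∏ a ∈ s, φ a x) ^ c⁻¹).toReal)) =ᵐ[μ]
      fun x => c⁻¹ * ∑ a ∈ s, llr (μ.map (T a)) (π.map (T a)) (T a x) := by
    filter_upwards [hφ0] with x hx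
    have h0 : ∀ a ∈ s, (φ a x).toReal ≠ 0 := fun a ha =>
      (ENNReal.toReal_pos (hx a ha).1 (hx a ha).2).ne'
    rw [← ENNReal.toReal_rpow, ENNReal.toReal_prod, Real.log_rpow
      (Finset.prod_pos fun a ha => ENNReal.toReal_pos (hx a ha).1 (hx a ha).2), Real.log_prod h0]
    rfl
  have hsum : Integrable (fun x => c⁻¹ * ∑ a ∈ s, llr (μ.map (T a)) (π.map (T a)) (T a x)) μ :=
    (integrable_finsetSum _ fun a _ => hintT a).const_mul _
  have hmain := integral_log_le_toReal_klDiv hμπ hint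
    ((Finset.measurable_fun_prod s fun a _ => hφm a).pow_const c⁻¹) hG1
    (by
      filter_upwards [hφ0] with x hx
      have h1 : ∏ a ∈ s, φ a x ≠ 0 := Finset.prod_ne_zero_iff.2 fun a ha => (hx a ha).1
      have h2 : ∏ a ∈ s, φ a x ≠ ∞ := ENNReal.prod_ne_top fun a ha => (hx a ha).2
      simp [ENNReal.rpow_eq_zero_iff, h1, h2])
    (by
      filter_upwards [hφ0] with x hx
      have h2 : ∏ a ∈ s, φ a x ≠ ∞ := ENNReal.prod_ne_top fun a ha => (hx a ha).2
      exact ENNReal.rpow_ne_top_of_nonneg (inv_nonneg.2 hc.le) h2)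
    (hsum.congr hlog.symm)
  rw [integral_congr_ae hlog, integral_const_mul, integral_finsetSum _ fun a _ => hintT a,
    Finset.sum_congr rfl fun a _ => hKL a, inv_mul_le_iff₀ hc] at hmain
  have hfina : ∀ a ∈ s, klDiv (μ.map (T a)) (π.map (T a)) ≠ ∞ := fun a _ =>
    klDiv_ne_top (hac a) (hinta a)
  rw [← ENNReal.toReal_sum hfina] at hmain
  rw [← ENNReal.ofReal_toReal (ENNReal.sum_ne_top.2 hfina), ← ENNReal.ofReal_toReal hfin,
    ← ENNReal.ofReal_mul hc.le]
  exact ENNReal.ofReal_le_ofReal hmain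

/-! ### Convexity of entropy and the block updates -/

/-- Jensen for the convex function `klFun`, applied pointwise to the densities with respect to π. -/
theorem klDiv_inv_smul_sum_le {α ι : Type*} [MeasurableSpace α] {s : Finset ι} {N : ℕ}
    (hN : s.card = N) (hN0 : 0 < N) (ν : ι → Measure α) (π : Measure α) [∀ a, IsFiniteMeasure (ν a)]
    [IsFiniteMeasure π] :
    klDiv ((N : ℝ≥0∞)⁻¹ • ∑ a ∈ s, ν a) π ≤ (N : ℝ≥0∞)⁻¹ * ∑ a ∈ s, klDiv (ν a) π := by
  have hNr : (0 : ℝ) < N := by exact_mod_cast hN0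
  by_cases hac : ∀ a ∈ s, ν a ≪ π
  swap
  · push Not at hac
    obtain ⟨a, ha, hna⟩ := hac
    rw [ENNReal.sum_eq_top.2 ⟨a, ha, klDiv_of_not_ac hna⟩, ENNReal.mul_top (by simp)]
    exact le_top
  set f : ι → α → ℝ≥0∞ := fun a => (ν a).rnDeriv π
  have hfm : ∀ a, Measurable (f a) := fun a => Measure.measurable_rnDeriv _ _
  set F : α → ℝ≥0∞ := fun x => (N : ℝ≥0∞)⁻¹ * ∑ a ∈ s, f a x
  have hsm : Measurable fun x => ∑ a ∈ s, f a x := Finset.measurable_fun_sum _ fun a _ => hfm a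
  have hFm : Measurable F := hsm.const_mul _
  have hF : (N : ℝ≥0∞)⁻¹ • ∑ a ∈ s, ν a = π.withDensity F := by
    ext B hB
    simp only [Measure.smul_apply, Measure.finsetSum_apply, smul_eq_mul, withDensity_apply _ hB, F]
    rw [lintegral_const_mul _ hsm, lintegral_finsetSum _ fun a _ => hfm a]
    congr 1
    refine Finset.sum_congr rfl fun a ha => ?_
    rw [← withDensity_apply _ hB, Measure.withDensity_rnDeriv_eq _ _ (hac a ha)]
  have hfin : IsFiniteMeasure ((N : ℝ≥0∞)⁻¹ • ∑ a ∈ s, ν a) := by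
    refine ⟨?_⟩
    simp only [Measure.smul_apply, Measure.finsetSum_apply, smul_eq_mul]
    refine ENNReal.mul_lt_top (by simp [hN0]) (ENNReal.sum_lt_top.2 fun a _ => measure_lt_top _ _)
  rw [klDiv_eq_lintegral_klFun_of_ac (hF ▸ withDensity_absolutelyContinuous _ _),
    Finset.sum_congr rfl fun a ha => klDiv_eq_lintegral_klFun_of_ac (hac a ha),
    ← lintegral_finsetSum _ fun a _ => by fun_prop, ← lintegral_const_mul _ (by fun_prop)]
  refine lintegral_mono_ae ?_
  have hlt : ∀ᵐ x ∂π, ∀ a ∈ s, f a x < ∞ := by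
    rw [Finset.eventually_all]
    exact fun a _ => Measure.rnDeriv_lt_top _ _
  have hrn : ((N : ℝ≥0∞)⁻¹ • ∑ a ∈ s, ν a).rnDeriv π =ᵐ[π] F := by
    rw [hF]; exact Measure.rnDeriv_withDensity π hFm
  filter_upwards [hrn, hlt] with x hx hltx
  have hJ := convexOn_klFun.map_sum_le (t := s) (w := fun _ => (N : ℝ)⁻¹)
    (p := fun a => (f a x).toReal) (fun _ _ => by positivity) (by simp [hN, hNr.ne'])
    (fun a _ => ENNReal.toReal_nonneg)
  simp only [smul_eq_mul, ← Finset.mul_sum] at hJ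
  have hFx : (F x).toReal = (N : ℝ)⁻¹ * ∑ a ∈ s, (f a x).toReal := by
    simp only [F, ENNReal.toReal_mul, ENNReal.toReal_inv, ENNReal.toReal_natCast]
    rw [ENNReal.toReal_sum fun a ha => (hltx a ha).ne]
  rw [hx, hFx]
  refine (ENNReal.ofReal_le_ofReal hJ).trans (le_of_eq ?_)
  rw [ENNReal.ofReal_mul (by positivity), ENNReal.ofReal_inv_of_pos hNr, ENNReal.ofReal_natCast,
    ENNReal.ofReal_sum_of_nonneg fun a _ => klFun_nonneg ENNReal.toReal_nonneg]

section
variable {M : ℕ} {d : Fin M → ℕ} (π : Measure (Space d)) [IsProbabilityMeasure π]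
  (S : Finset (Fin M))

/-- The point whose blocks in `S` are given and whose other blocks are `0`. -/
def extend {M : ℕ} {d : Fin M → ℕ} (S : Finset (Fin M)) (z : Blocks d S) : Space d :=
  replace S 0 z

theorem measurable_extend : Measurable (extend S : Blocks d S → Space d) :=
  (measurable_replace S).comp (measurable_const.prodMk measurable_id)

theorem proj_extend (z : Blocks d S) : proj S (extend S z) = z := by
  funext j
  simp [proj, extend, replace, j.2]

theorem replace_congr {x x' : Space d} (h : proj Sᶜ x = proj Sᶜ x') (y : Blocks d S) :
    replace S x y = replace S x' y := by
  unfold replace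
  congr 1
  funext j
  split_ifs with hj
  · rfl
  · exact congr_fun h ⟨j, by simpa using hj⟩

theorem replace_proj (x : Space d) : replace S x (proj S x) = x := by
  ext j
  simp [replace, proj]

instance : IsMarkovKernel (condBlocks π S) := by
  unfold condBlocks
  infer_instance

instance : IsMarkovKernel (blockUpdate π S) where
  isProbabilityMeasure x := by
    rw [blockUpdate_apply]
    exact Measure.isProbabilityMeasure_map
      ((measurable_replace S).comp measurable_prodMk_left).aemeasurable

theorem blockUpdate_congr {x x' : Space d} (h : proj Sᶜ x = proj Sᶜ x') :
    blockUpdate π S x = blockUpdate π S x' := by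
  rw [blockUpdate_apply, blockUpdate_apply, h]
  congr 1
  funext y
  exact replace_congr S h y

/-- The update forgets the blocks in S, so it factors through `proj Sᶜ`; zero-filling by `extend` is
an arbitrary choice of representative. This form lets data processing see only the marginal. -/
theorem blockUpdate_comp_eq (μ : Measure (Space d)) :
    blockUpdate π S ∘ₘ μ =
      ((blockUpdate π S).comap (extend Sᶜ) (measurable_extend Sᶜ)) ∘ₘ (μ.map (proj Sᶜ)) := by
  ext B hB
  rw [Measure.bind_apply hB (Kernel.aemeasurable _), Measure.bind_apply hB (Kernel.aemeasurable _),
    lintegral_map (Kernel.measurable_coe _ hB) (measurable_proj _)]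
  refine lintegral_congr fun x => ?_
  rw [Kernel.comap_apply, blockUpdate_congr π S (proj_extend Sᶜ (proj Sᶜ x))]

/-- Resampling from the conditional law reassembles π by disintegration. -/
theorem blockUpdate_comp_self : blockUpdate π S ∘ₘ π = π := by
  rw [blockUpdate_comp_eq]
  ext B hB
  have hm : Measurable fun p : Blocks d Sᶜ × Blocks d S => replace S (extend Sᶜ p.1) p.2 :=
    (measurable_replace S).comp
      (((measurable_extend Sᶜ).comp measurable_fst).prodMk measurable_snd)
  have hc : (π.map (proj Sᶜ)) ⊗ₘ condBlocks π S = π.map fun x => (proj Sᶜ x, proj S x) :=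
    compProd_map_condDistrib (measurable_proj S).aemeasurable
  rw [Measure.bind_apply hB (Kernel.aemeasurable _)]
  calc ∫⁻ z, (blockUpdate π S).comap (extend Sᶜ) (measurable_extend Sᶜ) z B ∂(π.map (proj Sᶜ))
      = ((π.map (proj Sᶜ)) ⊗ₘ condBlocks π S)
          ((fun p : Blocks d Sᶜ × Blocks d S => replace S (extend Sᶜ p.1) p.2) ⁻¹' B) := by
        rw [Measure.compProd_apply (hm hB)]
        refine lintegral_congr fun z => ?_
        rw [Kernel.comap_apply, blockUpdate_apply, proj_extend]
        exact Measure.map_apply (f := replace S (extend Sᶜ z)) (hm.comp measurable_prodMk_left) hB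
    _ = π B := by
        rw [hc, Measure.map_apply ((measurable_proj _).prodMk (measurable_proj _))
          (hm hB)]
        congr 1
        ext x
        simp only [mem_preimage]
        rw [replace_congr S (proj_extend Sᶜ (proj Sᶜ x)), replace_proj]

theorem klDiv_blockUpdate_comp_le (μ : Measure (Space d)) [IsProbabilityMeasure μ] :
    klDiv (blockUpdate π S ∘ₘ μ) π ≤ klDiv (μ.map (proj Sᶜ)) (π.map (proj Sᶜ)) := by
  have h := klDiv_comp_right_le (μ.map (proj Sᶜ)) (π.map (proj Sᶜ))
    ((blockUpdate π S).comap (extend Sᶜ) (measurable_extend Sᶜ))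
  rwa [← blockUpdate_comp_eq, ← blockUpdate_comp_eq, blockUpdate_comp_self] at h

theorem gibbs_comp (ℓ : ℕ) (μ : Measure (Space d)) :
    gibbs π ℓ ∘ₘ μ = ((M.choose ℓ : ℝ≥0∞))⁻¹ •
      ∑ S ∈ (Finset.univ : Finset (Fin M)).powersetCard ℓ, (blockUpdate π S ∘ₘ μ) := by
  ext B hB
  simp only [Measure.smul_apply, Measure.finsetSum_apply, smul_eq_mul,
    Measure.bind_apply hB (Kernel.aemeasurable _)]
  rw [← lintegral_finsetSum _ fun S _ => Kernel.measurable_coe _ hB,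
    ← lintegral_const_mul _ (Finset.measurable_fun_sum _ fun S _ => Kernel.measurable_coe _ hB)]
  refine lintegral_congr fun x => ?_
  simp [gibbs]

theorem klDiv_gibbs_comp_le {ℓ : ℕ} (hℓM : ℓ ≤ M) (μ : Measure (Space d))
    [IsProbabilityMeasure μ] :
    klDiv (gibbs π ℓ ∘ₘ μ) π ≤ (M.choose ℓ : ℝ≥0∞)⁻¹ *
      ∑ S ∈ (Finset.univ : Finset (Fin M)).powersetCard ℓ,
        klDiv (μ.map (proj Sᶜ)) (π.map (proj Sᶜ)) := by
  rw [gibbs_comp]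
  refine (klDiv_inv_smul_sum_le (by simp) (Nat.choose_pos hℓM) _ π).trans ?_
  gcongr
  exact klDiv_blockUpdate_comp_le π _ μ

end

/-! ### Choice of constants and the limit in t -/

theorem klDiv_eq_zero_of_subsingleton {α : Type*} [MeasurableSpace α] [Subsingleton α]
    (μ ν : Measure α) [IsProbabilityMeasure μ] [IsProbabilityMeasure ν] : klDiv μ ν = 0 := by
  have : μ = ν := by
    ext B _
    rcases B.eq_empty_or_nonempty with rfl | ⟨x, hx⟩
    · simp
    · have : B = univ := Set.eq_univ_of_forall fun y => Subsingleton.elim x y ▸ hx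
      simp [this]
  rw [this, klDiv_self]

section
variable {M : ℕ} {d : Fin M → ℕ} {U : Space d → ℝ} {lam : ℝ} {L : ℝ≥0}
  {π : Measure (Space d)} [IsProbabilityMeasure π] {ℓ : ℕ} (μ : Measure (Space d))
  [IsProbabilityMeasure μ]

theorem average_klDiv_map_proj_le_of_lt (hU : IsConvexSmooth U lam L)
    (hπ : π = volume.withDensity fun x => ENNReal.ofReal (Real.exp (-U x)))
    (hℓ : 1 ≤ ℓ) (hℓM : ℓ ≤ M) {t : ℝ} (ht0 : 0 < t) (ht1 : t < 1) (htL : t * L ≤ lam) :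
    (M.choose ℓ : ℝ≥0∞)⁻¹ * ∑ S ∈ (Finset.univ : Finset (Fin M)).powersetCard ℓ,
        klDiv (μ.map (proj Sᶜ)) (π.map (proj Sᶜ)) ≤
      ENNReal.ofReal (1 - t * (ℓ / M)) * klDiv μ π := by
  set s := (Finset.univ : Finset (Fin M)).powersetCard ℓ
  have hN : s.card = M.choose ℓ := by simp [s]
  have hNpos : (0 : ℝ) < M.choose ℓ := by exact_mod_cast Nat.choose_pos hℓM
  have hMpos : (0 : ℝ) < M := by exact_mod_cast (by omega : 0 < M)
  have hℓpos : (0 : ℝ) ≤ ℓ / M := by positivity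
  have hℓM1 : (ℓ : ℝ) / M ≤ 1 := (div_le_one hMpos).2 (by exact_mod_cast hℓM)
  -- The fraction of ℓ-sets containing a given block is ℓ/M, which produces the rate.
  have hNC : ((M - 1).choose (ℓ - 1) : ℝ) = M.choose ℓ * (ℓ / M) := by
    obtain ⟨m, rfl⟩ := Nat.exists_eq_add_of_le' (hℓ.trans hℓM)
    obtain ⟨k, rfl⟩ := Nat.exists_eq_add_of_le' hℓ
    have := Nat.add_one_mul_choose_eq m k
    rw [← mul_div_assoc, eq_div_iff hMpos.ne', mul_comm]
    exact_mod_cast this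
  have hceq : (s.card : ℝ) - t * ((M - 1).choose (ℓ - 1) : ℕ) =
      M.choose ℓ * (1 - t * (ℓ / M)) := by rw [hN, hNC]; ring
  have h1 : 0 < 1 - t * (ℓ / M) := by nlinarith
  have hC : ∀ j : (m : Fin M) × Fin (d m),
      (s.filter fun S => j ∈ {j : (m : Fin M) × Fin (d m) | j.1 ∈ S}).card =
        (M - 1).choose (ℓ - 1) := fun j => by
    simpa using card_filter_mem_powersetCard hℓ j.1
  have key := sum_klDiv_map_le s
    (fun S : Finset (Fin M) => {j : (m : Fin M) × Fin (d m) | j.1 ∈ S})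
    (T := fun S => proj Sᶜ) (μ := μ) hU.differentiable.continuous hπ ht0 ht1 hC
    (Nat.choose_pos (by omega)) (by rw [hceq]; positivity)
    (sum_interp_le s _ hU.differentiable hU.smooth hU.strongly_convex ht0.le htL hC)
    (fun S => measurable_proj Sᶜ) (fun S x y => by
      funext j
      have hj : j.1.1 ∉ S := by simpa using j.2
      simp [proj, interp, hj])
  refine (mul_le_mul_right key _).trans (le_of_eq ?_)
  rw [hceq, ENNReal.ofReal_mul hNpos.le, ENNReal.ofReal_natCast, ← mul_assoc, ← mul_assoc,
    ENNReal.inv_mul_cancel (by exact_mod_cast hNpos.ne') (ENNReal.natCast_ne_top _), one_mul]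

theorem average_klDiv_map_proj_le (hU : IsConvexSmooth U lam L)
    (hπ : π = volume.withDensity fun x => ENNReal.ofReal (Real.exp (-U x)))
    {κ : ℝ} (hκ : κ = L / lam) (hℓ : 1 ≤ ℓ) (hℓM : ℓ ≤ M) :
    (M.choose ℓ : ℝ≥0∞)⁻¹ * ∑ S ∈ (Finset.univ : Finset (Fin M)).powersetCard ℓ,
        klDiv (μ.map (proj Sᶜ)) (π.map (proj Sᶜ)) ≤
      ENNReal.ofReal (1 - ℓ / (κ * M)) * klDiv μ π := by
  have hprob : ∀ (ν : Measure (Space d)) [IsProbabilityMeasure ν] (S : Finset (Fin M)),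
      IsProbabilityMeasure (ν.map (proj Sᶜ)) := fun ν _ S =>
    Measure.isProbabilityMeasure_map (measurable_proj _).aemeasurable
  -- In dimension zero λ ≤ L may fail, but all entropies vanish.
  rcases subsingleton_or_nontrivial (Space d) with hsub | hnt
  · have : ∀ S : Finset (Fin M), klDiv (μ.map (proj Sᶜ)) (π.map (proj Sᶜ)) = 0 := fun S => by
      have : μ = π := klDiv_eq_zero_iff.1 (klDiv_eq_zero_of_subsingleton μ π)
      rw [this, klDiv_self]
    simp [this]
  have hlam := hU.lam_pos
  have hlL : lam ≤ L :=
    strong_convexity_le_lipschitz hU.differentiable hU.smooth hU.strongly_convex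
  have hL : (0 : ℝ) < L := hlam.trans_le hlL
  have hMpos : (0 : ℝ) < M := by exact_mod_cast (by omega : 0 < M)
  have hτ0 : 0 < lam / L := div_pos hlam hL
  have hτ1 : lam / L ≤ 1 := (div_le_one hL).2 hlL
  have hκe : ℓ / (κ * M) = lam / L * (ℓ / M) := by rw [hκ]; field_simp
  rw [hκe]
  -- With infinite entropy the product could be 0·∞ only if ℓ = M, and then the marginals live on a
  -- point and the left side is zero. With finite entropy the bound is continuous in t, so t < λ/L ≤
  -- 1 may tend to λ/L; Prékopa–Leindler requires t < 1 strictly.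
  rcases eq_or_ne (klDiv μ π) ∞ with htop | hfin
  · rcases hℓM.eq_or_lt with rfl | hlt
    · rw [Finset.sum_eq_zero fun S hS => ?_, mul_zero]
      · exact zero_le
      · have hS' : S = Finset.univ :=
          (Finset.card_eq_iff_eq_univ S).1 (by simpa using (Finset.mem_powersetCard.1 hS).2)
        have : Subsingleton (Blocks d Sᶜ) :=
          ⟨fun x y => funext fun j => absurd j.2 (by simp [hS'])⟩
        exact klDiv_eq_zero_of_subsingleton _ _
    · rw [htop, ENNReal.mul_top]
      · exact le_top
      · have : (ℓ : ℝ) / M < 1 := (div_lt_one hMpos).2 (by exact_mod_cast hlt)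
        have : 0 ≤ (ℓ : ℝ) / M := by positivity
        simp only [ne_eq, ENNReal.ofReal_eq_zero, not_le]
        nlinarith
  · have hlim : Tendsto (fun t : ℝ => ENNReal.ofReal (1 - t * (ℓ / M)) * klDiv μ π)
        (𝓝[<] (lam / L)) (𝓝 (ENNReal.ofReal (1 - lam / L * (ℓ / M)) * klDiv μ π)) := by
      refine ENNReal.Tendsto.mul_const ?_ (Or.inr hfin)
      refine ((ENNReal.continuous_ofReal.comp (by fun_prop :
        Continuous fun t : ℝ => 1 - t * (ℓ / M))).tendsto _).mono_left nhdsWithin_le_nhds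
    refine ge_of_tendsto hlim ?_
    filter_upwards [Ioo_mem_nhdsLT hτ0] with t ht
    exact average_klDiv_map_proj_le_of_lt μ hU hπ hℓ hℓM ht.1 (ht.2.trans_le hτ1)
      ((le_div_iff₀ hL).1 ht.2.le)

end

end BlockGibbs

theorem mainTheorem4 {M : ℕ} (d : Fin M → ℕ) (U : BlockGibbs.Space d → ℝ) (lam : ℝ) (L : ℝ≥0)
    (hU : BlockGibbs.IsConvexSmooth U lam L)
    (π : Measure (BlockGibbs.Space d)) [IsProbabilityMeasure π]
    (hπ : π = volume.withDensity fun x => ENNReal.ofReal (Real.exp (-U x)))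
    (κ : ℝ) (hκ : κ = L / lam)
    (ℓ : ℕ) (hℓ : 1 ≤ ℓ) (hℓM : ℓ ≤ M)
    (μ : Measure (BlockGibbs.Space d)) [IsProbabilityMeasure μ] :
    klDiv (BlockGibbs.gibbs π ℓ ∘ₘ μ) π ≤
        ENNReal.ofReal (1 - ℓ / (κ * M)) * klDiv μ π ∧
      (M.choose ℓ : ℝ≥0∞)⁻¹ *
          ∑ S ∈ (Finset.univ : Finset (Fin M)).powersetCard ℓ,
            klDiv (μ.map (BlockGibbs.proj Sᶜ)) (π.map (BlockGibbs.proj Sᶜ)) ≤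
        ENNReal.ofReal (1 - ℓ / (κ * M)) * klDiv μ π := by
  have h := BlockGibbs.average_klDiv_map_proj_le μ hU hπ hκ hℓ hℓM
  exact ⟨(BlockGibbs.klDiv_gibbs_comp_le π hℓM μ).trans h, h⟩
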